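/- Let $\mathcal V$ denote a finite-dimensional complex Hilbert space. Let $H(s)$, $s\in[0,1]$, be a differentiable path of self-adjoint operators (Hamiltonians) on $\mathcal V$ with $\|\dot H\| := \sup_{s\in[0,1]}\|\partial_s H(s)\| < \infty$ (operator norm), let $\psi(s)$, $s\in[0,1]$, be unit vectors such that the projectors $|\psi(s)\rangle\langle\psi(s)|$ depend continuously on $s$ and each $\psi(s)$ is an eigenvector of $H(s)$ with nondegenerate eigenvalue $E(s)$, and let $\Delta>0$ be a lower bound on the absolute spectral gap: $|E'-E(s)|\ge\Delta$ for every $s$ and every eigenvalue $E'\ne E(s)$ of $H(s)$. For a probability measure $\mu$ on $\mathbb R$ and a number of steps $q\in\mathbb N$, the randomization method starts in $\rho_0=|\psi(0)\rangle\langle\psi(0)|$ and, for $k=1,\dots,q$, evolves under $H(k/q)$ for an independent random time $t$ with law $\mu$, that is, $$\rho_k=\int_{\mathbb R} e^{-iH(k/q)t}\,\rho_{k-1}\,e^{iH(k/q)t}\,d\mu(t).$$ Its output is $\rho_q$, and its cost is the average sum of the absolute evolution times, $q\int|t|\,d\mu(t)$. Then $\psi(1)$ can be prepared from $\psi(0)$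 with bounded error at cost $O\big(\frac{\|\dot H\|^2}{\Delta^3}(\log(\|\dot H\|/\Delta))^{\alpha}\big)$, where $\alpha=0$ if negative evolution times are allowed and $\alpha=1$ otherwise. Precisely: for every $\varepsilon\in(0,1)$ there is a constant $C>0$, depending only on $\varepsilon$, such that for all $M\ge0$, $\Delta>0$ and $\alpha\in\{0,1\}$ there are $q\in\mathbb N$ and a probability measure $\mu$ on $\mathbb R$, supported on $[0,\infty)$ if $\alpha=1$, with $$q\int|t|\,d\mu(t)\ \le\ C\,\frac{M^2}{\Delta^3}\,\big(\max\{1,\log(M/\Delta)\}\big)^{\alpha},$$ and such that for every $\mathcal V$, $H$, $\psi$ as above with gap bound $\Delta$ and $\|\dot H\|=M$ the output satisfies $\langle\psi(1)|\rho_q|\psi(1)\rangle\ge 1-\varepsilon$. -/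

import Mathlib

open MeasureTheory Set
open scoped ENNReal

noncomputable section

namespace PhaseRandomization

variable {V : Type*} [NormedAddCommGroup V] [InnerProductSpace ℂ V]

/-- The rank-one operator `|v⟩⟨v|`; it is the orthogonal projection onto the line of `v`
when `v` is a unit vector. -/
def proj (v : V) : V →L[ℂ] V := InnerProductSpace.rankOne ℂ v v

/-- The evolution operator `e^{-iAt}` of the Hamiltonian `A` for the (possibly negative) time `t`. -/
def evolution (A : V →L[ℂ] V) (t : ℝ) : V →L[ℂ] V :=
  NormedSpace.exp ((-(Complex.I * (t : ℂ))) • A)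

/-- The quantum operation `ρ ↦ ∫ e^{-iAt} ρ e^{iAt} dμ(t)`: evolution under the Hamiltonian `A`
for a random time with law `μ`. -/
def randomizedEvolution (A : V →L[ℂ] V) (μ : Measure ℝ) (ρ : V →L[ℂ] V) : V →L[ℂ] V :=
  ∫ t : ℝ, evolution A t * ρ * evolution A (-t) ∂μ

/-- State of the randomization method after `k` of its `q` steps, started in `ρ`. The `j`-th step
(`j = 1, …, q`) evolves under `H (j / q)` for an independent random time with law `μ`. -/
def stateAfter (H : ℝ → V →L[ℂ] V) (μ : Measure ℝ) (q : ℕ) (ρ : V →L[ℂ] V) : ℕ → V →L[ℂ] V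
  | 0 => ρ
  | k + 1 => randomizedEvolution (H (((k + 1 : ℕ) : ℝ) / (q : ℝ))) μ (stateAfter H μ q ρ k)

/-- Output of the randomization method with `q` steps, started in the pure state `v`. -/
def output (H : ℝ → V →L[ℂ] V) (μ : Measure ℝ) (q : ℕ) (v : V) : V →L[ℂ] V :=
  stateAfter H μ q (proj v) q

/-- The fidelity `⟨v|ρ|v⟩ = tr(|v⟩⟨v| ρ)` of the state `ρ` with the unit vector `v`. -/
def fidelity (v : V) (ρ : V →L[ℂ] V) : ℝ := (inner ℂ v (ρ v)).re

/-- Average sum of the absolute evolution times of `q` steps whose times have law `μ`. -/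
def averageCost (q : ℕ) (μ : Measure ℝ) : ℝ≥0∞ :=
  (q : ℝ≥0∞) * ∫⁻ t : ℝ, ENNReal.ofReal |t| ∂μ

/-- `sup_{s ∈ [0,1]} ‖∂ₛ H(s)‖`, in the operator norm (one-sided derivatives at `0` and `1`). -/
def derivSup (H : ℝ → V →L[ℂ] V) : ℝ :=
  ⨆ s : Icc (0 : ℝ) 1, ‖derivWithin H (Icc (0 : ℝ) 1) (s : ℝ)‖

/-- `H(s)`, `s ∈ [0,1]`, is a differentiable path of Hamiltonians whose derivative has finite
supremum norm, and `ψ(s)` is a projectively continuous path of normalized nondegenerate eigenstates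
of `H(s)`, separated from the rest of the spectrum of `H(s)` by a gap of absolute value at
least `Δ`. -/
structure IsEigenpath (H : ℝ → V →L[ℂ] V) (ψ : ℝ → V) (Δ : ℝ) : Prop where
  symmetric : ∀ s ∈ Icc (0 : ℝ) 1, (H s : V →ₗ[ℂ] V).IsSymmetric
  differentiable : DifferentiableOn ℝ H (Icc (0 : ℝ) 1)
  bddAbove : BddAbove (range fun s : Icc (0 : ℝ) 1 => ‖derivWithin H (Icc (0 : ℝ) 1) (s : ℝ)‖)
  norm_eq_one : ∀ s ∈ Icc (0 : ℝ) 1, ‖ψ s‖ = 1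
  continuous : ContinuousOn (fun s => proj (ψ s)) (Icc (0 : ℝ) 1)
  eigenstate : ∀ s ∈ Icc (0 : ℝ) 1, ∃ E : ℝ,
    H s (ψ s) = (E : ℂ) • ψ s ∧
    Module.finrank ℂ (Module.End.eigenspace (H s : V →ₗ[ℂ] V) (E : ℂ)) = 1 ∧
    ∀ E' : ℝ, Module.End.HasEigenvalue (H s : V →ₗ[ℂ] V) (E' : ℂ) → E' ≠ E → Δ ≤ |E' - E|

end PhaseRandomization

end

/-! In an eigenbasis of `A`, evolution for a random time multiplies the matrix element of `ρ`
between eigenvectors of energies `l` and `E` by `charFun μ (E - l)`. A step thus preserves the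
population of the tracked eigenstate `ψ` exactly, and shrinks its coherences with all other
eigenvectors to at most `η` whenever `‖charFun μ ω‖ ≤ η` for `|ω| ≥ Δ`.

When `ψ` is almost an eigenvector of `ρ` in this sense, passing to the next eigenstate, at sine
distance at most `β`, costs fidelity only `β ^ 2 + 2 * β * η` (`fidelity_sub_le`). Perturbation
theory gives `β = 2M/(Δq)`, so with `x = M/Δ` the total loss is at most `4x²/q + 4xη`; `q ≈ 8x²/ε`
and `η ≤ ε/(8x)` suffice.

It remains to find cheap laws. If negative times are allowed, a density `‖𝓕 f‖²` with `f` a narrow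
bump gives `η = 0` at mean time `O(1/Δ)`. For nonnegative times, an `n`-fold convolution of uniform
laws gives `η = 2⁻ⁿ` at mean time `O(n/Δ)`, and `n` of order `log x` is enough. -/

namespace PhaseRandomization

/-! ### Eigenvector expansions and unitary evolution -/

variable {V : Type*} [NormedAddCommGroup V] [InnerProductSpace ℂ V]

/-- The component of `u` orthogonal to a nondegenerate eigenvector `ψ` of a symmetric operator is
controlled by the overlaps of `u` with the other eigenvectors. -/
lemma norm_sub_inner_smul_le [FiniteDimensional ℂ V] {T : V →L[ℂ] V}
    (hT : (T : V →ₗ[ℂ] V).IsSymmetric) {ψ : V} (hψ : ‖ψ‖ = 1) {E : ℝ} (hE : T ψ = (E : ℂ) • ψ)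
    (hrank : Module.finrank ℂ (Module.End.eigenspace (T : V →ₗ[ℂ] V) (E : ℂ)) = 1)
    {u w : V} {η : ℝ} (hη : 0 ≤ η)
    (h : ∀ (φ : V) (l : ℝ), T φ = (l : ℂ) • φ →
      Module.End.HasEigenvalue (T : V →ₗ[ℂ] V) (l : ℂ) → l ≠ E →
      ‖inner ℂ φ u‖ ≤ η * ‖inner ℂ φ w‖) :
    ‖u - inner ℂ ψ u • ψ‖ ≤ η * ‖w‖ := by
  set b := hT.eigenvectorBasis rfl
  set e := hT.eigenvalues rfl
  have hψ0 : ψ ≠ 0 := by rintro rfl; simp at hψ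
  have hb : ∀ i, T (b i) = (e i : ℂ) • b i := fun i => hT.apply_eigenvectorBasis rfl i
  have hψψ : inner ℂ ψ ψ = 1 := by
    rw [inner_self_eq_norm_sq_to_K, hψ]; simp
  have key : ∀ i, ‖inner ℂ (b i) (u - inner ℂ ψ u • ψ)‖ ≤ η * ‖inner ℂ (b i) w‖ := by
    intro i
    -- If `e i = E`, nondegeneracy makes `b i` a multiple of `ψ`, which is orthogonal to the
    -- residual; otherwise `b i` is orthogonal to `ψ`.
    by_cases hi : e i = E
    · have h1 := (finrank_eq_one_iff_of_nonzero'
        (⟨ψ, Module.End.mem_eigenspace_iff.2 hE⟩ :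
          Module.End.eigenspace (T : V →ₗ[ℂ] V) (E : ℂ)) (by simpa using hψ0)).1 hrank
        ⟨b i, Module.End.mem_eigenspace_iff.2 (by simpa [hi] using hb i)⟩
      obtain ⟨c, hc⟩ := h1
      have hc' : c • ψ = b i := congrArg Subtype.val hc
      rw [← hc', inner_smul_left, inner_sub_right, inner_smul_right, hψψ]
      simp only [mul_one, sub_self, mul_zero, norm_zero]
      positivity
    · have h2 : inner ℂ (b i) ψ = 0 := by
        have h3 : inner ℂ (T (b i)) ψ = inner ℂ (b i) (T ψ) := hT _ _
        rw [hb, hE, inner_smul_left, inner_smul_right, Complex.conj_ofReal] at h3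
        have h4 : ((e i : ℂ) - E) * inner ℂ (b i) ψ = 0 := by rw [sub_mul, h3, sub_self]
        refine (mul_eq_zero.1 h4).resolve_left fun h5 => hi ?_
        exact_mod_cast sub_eq_zero.1 h5
      rw [inner_sub_right, inner_smul_right, h2, mul_zero, sub_zero]
      exact h _ _ (hb i) (hT.hasEigenvalue_eigenvalues rfl i) hi
  rw [← sq_le_sq₀ (norm_nonneg _) (by positivity), mul_pow, ← b.sum_sq_norm_inner_right,
    ← b.sum_sq_norm_inner_right w, Finset.mul_sum]
  refine Finset.sum_le_sum fun i _ => ?_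
  rw [← mul_pow]
  exact pow_le_pow_left₀ (norm_nonneg _) (key i) 2

lemma continuous_evolution [CompleteSpace V] (A : V →L[ℂ] V) : Continuous (evolution A) := by
  let _ : NormedAlgebra ℚ (V →L[ℂ] V) := NormedAlgebra.restrictScalars ℚ ℂ _
  unfold evolution
  exact NormedSpace.exp_continuous.comp (by fun_prop)

lemma evolution_apply_of_eigenvector [CompleteSpace V] {A : V →L[ℂ] V} {φ : V} {l : ℝ}
    (h : A φ = (l : ℂ) • φ) (t : ℝ) :
    evolution A t φ = Complex.exp (-(l * t * Complex.I)) • φ := by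
  have h0 : ((-(Complex.I * (t : ℂ))) • A) φ = (-(l * t * Complex.I)) • φ := by
    rw [smul_apply, h, smul_smul]
    congr 1
    ring
  have h1 : ∀ n : ℕ, (((-(Complex.I * (t : ℂ))) • A) ^ n) φ = (-(l * t * Complex.I)) ^ n • φ := by
    intro n
    induction n with
    | zero => simp
    | succ n ih =>
      rw [pow_succ, mul_apply_eq_comp, h0, map_smul, ih, smul_smul, pow_succ']
  have h2 := (NormedSpace.exp_series_hasSum_exp' (𝕂 := ℂ) ((-(Complex.I * (t : ℂ))) • A)).mapL
    (ContinuousLinearMap.apply ℂ V φ)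
  have h3 := (NormedSpace.exp_series_hasSum_exp' (𝕂 := ℂ) (-(l * t * Complex.I))).smul_const φ
  rw [← Complex.exp_eq_exp_ℂ] at h3
  refine h2.unique ?_
  convert h3 using 2 with n
  simp only [ContinuousLinearMap.apply_apply, smul_apply, h1, smul_eq_mul,
    mul_smul]

lemma star_evolution [CompleteSpace V] {A : V →L[ℂ] V}
    (hA : (A : V →ₗ[ℂ] V).IsSymmetric) (t : ℝ) :
    star (evolution A t) = evolution A (-t) := by
  have hA' : star A = A := (ContinuousLinearMap.isSelfAdjoint_iff_isSymmetric.2 hA)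
  rw [evolution, NormedSpace.star_exp, star_smul, hA', evolution]
  congr 2
  simp

lemma inner_evolution_left [CompleteSpace V] {A : V →L[ℂ] V}
    (hA : (A : V →ₗ[ℂ] V).IsSymmetric) (t : ℝ) (x y : V) :
    inner ℂ x (evolution A t y) = inner ℂ (evolution A (-t) x) y := by
  rw [← star_evolution hA, ContinuousLinearMap.star_eq_adjoint,
    ContinuousLinearMap.adjoint_inner_left]

lemma evolution_mul_evolution_neg [CompleteSpace V] (A : V →L[ℂ] V) (t : ℝ) :
    evolution A t * evolution A (-t) = 1 := by
  let _ : NormedAlgebra ℚ (V →L[ℂ] V) := NormedAlgebra.restrictScalars ℚ ℂ _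
  have h : ((-(Complex.I * ((-t : ℝ) : ℂ))) • A) = -((-(Complex.I * (t : ℂ))) • A) := by
    rw [← neg_smul]; congr 1; push_cast; ring
  rw [evolution, evolution, h,
    ← NormedSpace.exp_add_of_commute ((Commute.refl _).neg_right), add_neg_cancel,
    NormedSpace.exp_zero]

lemma norm_evolution_le_one [CompleteSpace V] {A : V →L[ℂ] V}
    (hA : (A : V →ₗ[ℂ] V).IsSymmetric) (t : ℝ) : ‖evolution A t‖ ≤ 1 := by
  have h : ‖evolution A t‖ * ‖evolution A t‖ = ‖(1 : V →L[ℂ] V)‖ := by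
    rw [← CStarRing.norm_self_mul_star, star_evolution hA, evolution_mul_evolution_neg]
  have h1 : ‖(1 : V →L[ℂ] V)‖ ≤ 1 := ContinuousLinearMap.norm_id_le
  nlinarith [norm_nonneg (evolution A t)]

lemma norm_conj_evolution_le [CompleteSpace V] {A : V →L[ℂ] V}
    (hA : (A : V →ₗ[ℂ] V).IsSymmetric) (ρ : V →L[ℂ] V) (t : ℝ) :
    ‖evolution A t * ρ * evolution A (-t)‖ ≤ ‖ρ‖ := by
  calc _ ≤ ‖evolution A t‖ * ‖ρ‖ * ‖evolution A (-t)‖ :=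
        (norm_mul_le _ _).trans (by gcongr; exact norm_mul_le _ _)
    _ ≤ 1 * ‖ρ‖ * 1 := by
        gcongr
        exacts [norm_evolution_le_one hA t, norm_evolution_le_one hA (-t)]
    _ = ‖ρ‖ := by ring

/-! ### The randomized evolution as a quantum operation -/

variable [FiniteDimensional ℂ V] {A : V →L[ℂ] V}

lemma integrable_conj_evolution (hA : (A : V →ₗ[ℂ] V).IsSymmetric) (μ : Measure ℝ)
    [IsFiniteMeasure μ] (ρ : V →L[ℂ] V) :
    Integrable (fun t : ℝ => evolution A t * ρ * evolution A (-t)) μ := by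
  have := FiniteDimensional.complete ℂ V
  have hc := continuous_evolution A
  have hc' : Continuous fun t : ℝ => evolution A t * ρ * evolution A (-t) :=
    (hc.mul continuous_const).mul (hc.comp continuous_neg)
  exact Integrable.of_bound hc'.aestronglyMeasurable ‖ρ‖
    (Filter.Eventually.of_forall fun t => norm_conj_evolution_le hA ρ t)

lemma inner_randomizedEvolution (hA : (A : V →ₗ[ℂ] V).IsSymmetric) (μ : Measure ℝ)
    [IsFiniteMeasure μ] (ρ : V →L[ℂ] V) (x y : V) :
    inner ℂ x (randomizedEvolution A μ ρ y)
      = ∫ t, inner ℂ (evolution A (-t) x) (ρ (evolution A (-t) y)) ∂μ := by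
  have := FiniteDimensional.complete ℂ V
  have h := ContinuousLinearMap.integral_comp_comm
    ((innerSL ℂ x).comp (ContinuousLinearMap.apply ℂ V y)) (integrable_conj_evolution hA μ ρ)
  refine h.symm.trans (integral_congr_ae (Filter.Eventually.of_forall fun t => ?_))
  exact inner_evolution_left hA t _ _

lemma norm_randomizedEvolution_le (hA : (A : V →ₗ[ℂ] V).IsSymmetric) (μ : Measure ℝ)
    [IsProbabilityMeasure μ] (ρ : V →L[ℂ] V) : ‖randomizedEvolution A μ ρ‖ ≤ ‖ρ‖ := by
  have := FiniteDimensional.complete ℂ V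
  simpa [randomizedEvolution] using norm_integral_le_of_norm_le_const (μ := μ)
    (Filter.Eventually.of_forall fun t => norm_conj_evolution_le hA ρ t)

lemma isPositive_randomizedEvolution (hA : (A : V →ₗ[ℂ] V).IsSymmetric) (μ : Measure ℝ)
    [IsFiniteMeasure μ] {ρ : V →L[ℂ] V} (hρ : ρ.IsPositive) :
    (randomizedEvolution A μ ρ).IsPositive := by
  refine ⟨fun x y => ?_, fun x => ?_⟩
  · change inner ℂ (randomizedEvolution A μ ρ x) y = inner ℂ x (randomizedEvolution A μ ρ y)
    rw [← inner_conj_symm, inner_randomizedEvolution hA, inner_randomizedEvolution hA,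
      ← integral_conj]
    refine integral_congr_ae (Filter.Eventually.of_forall fun t => ?_)
    simp only [inner_conj_symm]
    exact hρ.inner_left_eq_inner_right _ _
  · change 0 ≤ RCLike.re (inner ℂ (randomizedEvolution A μ ρ x) x)
    rw [inner_re_symm, inner_randomizedEvolution hA]
    have h : ∀ t : ℝ, inner ℂ (evolution A (-t) x) (ρ (evolution A (-t) x))
        = ((inner ℂ (evolution A (-t) x) (ρ (evolution A (-t) x))).re : ℂ) := fun t => by
      have := hρ.inner_nonneg_right (evolution A (-t) x)
      exact Complex.eq_re_of_ofReal_le this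
    rw [integral_congr_ae (Filter.Eventually.of_forall h), integral_complex_ofReal]
    exact integral_nonneg fun t => hρ.re_inner_nonneg_right _

/-- The two eigenvectors only pick up phases, whose product `e^{i(E-l)t}` averages to the
characteristic function. The case `l = E` gives factor 1 (populations), the case `l ≠ E` the
suppression of coherences. -/
lemma inner_randomizedEvolution_of_eigenvectors (hA : (A : V →ₗ[ℂ] V).IsSymmetric)
    (μ : Measure ℝ) [IsFiniteMeasure μ] (ρ : V →L[ℂ] V) {φ ψ : V} {l E : ℝ}
    (hφ : A φ = (l : ℂ) • φ) (hψ : A ψ = (E : ℂ) • ψ) :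
    inner ℂ φ (randomizedEvolution A μ ρ ψ) = charFun μ (E - l) * inner ℂ φ (ρ ψ) := by
  have := FiniteDimensional.complete ℂ V
  rw [inner_randomizedEvolution hA, charFun_apply_real, ← integral_mul_const]
  refine integral_congr_ae (Filter.Eventually.of_forall fun t => ?_)
  simp only [evolution_apply_of_eigenvector hφ, evolution_apply_of_eigenvector hψ, map_smul,
    inner_smul_left, inner_smul_right, ← Complex.exp_conj, ← mul_assoc, ← Complex.exp_add]
  congr 2
  simp
  ring

end PhaseRandomization

namespace PhaseRandomization

/-! ### Fidelity under a change of reference state -/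

variable {V : Type*} [NormedAddCommGroup V] [InnerProductSpace ℂ V]

lemma inner_self_of_norm_eq_one {ψ : V} (hψ : ‖ψ‖ = 1) : inner ℂ ψ ψ = 1 := by
  rw [inner_self_eq_norm_sq_to_K, hψ]; simp

lemma fidelity_le_norm {ψ : V} (hψ : ‖ψ‖ = 1) (ρ : V →L[ℂ] V) : fidelity ψ ρ ≤ ‖ρ‖ := by
  calc fidelity ψ ρ ≤ ‖inner ℂ ψ (ρ ψ)‖ := Complex.re_le_norm _
    _ ≤ ‖ψ‖ * ‖ρ ψ‖ := norm_inner_le_norm _ _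
    _ ≤ ‖ρ‖ := by simpa [hψ] using ρ.le_opNorm ψ

/-- Replacing the reference state `ψ` by a nearby state `ψ'` lowers the fidelity only to second
order if `ψ` is almost an eigenvector of `ρ`. -/
lemma fidelity_sub_le {ψ ψ' : V} (hψ : ‖ψ‖ = 1) (hψ' : ‖ψ'‖ = 1) {ρ : V →L[ℂ] V}
    (hρ : ρ.IsPositive) (hρ1 : ‖ρ‖ ≤ 1) {η β : ℝ}
    (hη : ‖ρ ψ - inner ℂ ψ (ρ ψ) • ψ‖ ≤ η) (hβ : ‖ψ' - inner ℂ ψ ψ' • ψ‖ ≤ β) :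
    fidelity ψ ρ - (β ^ 2 + 2 * β * η) ≤ fidelity ψ' ρ := by
  set a := inner ℂ ψ ψ' with ha
  set y := ψ' - a • ψ with hy
  have hψψ := inner_self_of_norm_eq_one hψ
  have hψy : inner ℂ ψ y = 0 := by
    rw [hy, inner_sub_right, inner_smul_right, hψψ, ← ha]; ring
  have hψ'y : ψ' = a • ψ + y := by rw [hy]; abel
  have hpyth : ‖a‖ ^ 2 + ‖y‖ ^ 2 = 1 := by
    have h := norm_add_sq_eq_norm_sq_add_norm_sq_of_inner_eq_zero (𝕜 := ℂ) (a • ψ) y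
      (by rw [inner_smul_left, hψy, mul_zero])
    rw [← hψ'y, hψ', norm_smul, hψ] at h
    nlinarith
  -- Since `y` is orthogonal to `ψ`, only the part of `ρ ψ` orthogonal to `ψ` contributes; this
  -- makes the cross term second order.
  have hcross : ‖inner ℂ (ρ ψ) y‖ ≤ η * β := by
    have h : inner ℂ (ρ ψ) y = inner ℂ (ρ ψ - inner ℂ ψ (ρ ψ) • ψ) y := by
      rw [inner_sub_left, inner_smul_left, hψy]; ring
    rw [h]
    refine (norm_inner_le_norm _ _).trans ?_
    have := norm_nonneg (ρ ψ - inner ℂ ψ (ρ ψ) • ψ)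
    gcongr
    linarith
  have hexp : fidelity ψ' ρ = ‖a‖ ^ 2 * fidelity ψ ρ
      + 2 * ((starRingEnd ℂ) a * inner ℂ (ρ ψ) y).re + (inner ℂ y (ρ y)).re := by
    have h1 : inner ℂ ψ (ρ y) = inner ℂ (ρ ψ) y := (hρ.inner_left_eq_inner_right _ _).symm
    have h2 : inner ℂ y (ρ ψ) = (starRingEnd ℂ) (inner ℂ (ρ ψ) y) := (inner_conj_symm _ _).symm
    have h3 : (starRingEnd ℂ) a * (a * inner ℂ ψ (ρ ψ)) = (‖a‖ ^ 2 : ℝ) * inner ℂ ψ (ρ ψ) := by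
      rw [← mul_assoc, Complex.conj_mul']; push_cast; rfl
    rw [fidelity, hψ'y, map_add, map_smul, inner_add_left, inner_add_right, inner_add_right,
      inner_smul_left, inner_smul_left, inner_smul_right, inner_smul_right, h1, h2, h3]
    simp only [Complex.add_re, fidelity, Complex.mul_re, Complex.conj_re, Complex.conj_im,
      Complex.ofReal_re, Complex.ofReal_im]
    ring
  have hre : -(η * β) ≤ ((starRingEnd ℂ) a * inner ℂ (ρ ψ) y).re := by
    have h1 := Complex.abs_re_le_norm ((starRingEnd ℂ) a * inner ℂ (ρ ψ) y)
    rw [norm_mul, Complex.norm_conj] at h1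
    have h2 : ‖a‖ ≤ 1 := by nlinarith [norm_nonneg a, sq_nonneg ‖y‖]
    have h3 : ‖a‖ * ‖inner ℂ (ρ ψ) y‖ ≤ 1 * (η * β) := by gcongr
    linarith [neg_abs_le ((starRingEnd ℂ) a * inner ℂ (ρ ψ) y).re]
  have hpos : 0 ≤ (inner ℂ y (ρ y)).re := hρ.re_inner_nonneg_right y
  have hF : fidelity ψ ρ ≤ 1 := (fidelity_le_norm hψ ρ).trans hρ1
  have hy2 : ‖y‖ ^ 2 ≤ β ^ 2 := pow_le_pow_left₀ (norm_nonneg _) hβ 2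
  have hmul : ‖y‖ ^ 2 * fidelity ψ ρ ≤ ‖y‖ ^ 2 * 1 := by gcongr
  have : ‖a‖ ^ 2 * fidelity ψ ρ = fidelity ψ ρ - ‖y‖ ^ 2 * fidelity ψ ρ := by
    linear_combination fidelity ψ ρ * hpyth
  rw [hexp, this]
  linarith

/-! ### Perturbation theory along the eigenpath -/

namespace IsEigenpath

variable {H : ℝ → V →L[ℂ] V} {ψ : ℝ → V} {Δ : ℝ}

lemma derivSup_nonneg (H : ℝ → V →L[ℂ] V) : 0 ≤ derivSup H :=
  Real.iSup_nonneg fun _ => norm_nonneg _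

lemma norm_sub_le (h : IsEigenpath H ψ Δ) {s t : ℝ} (hs : s ∈ Icc (0 : ℝ) 1)
    (ht : t ∈ Icc (0 : ℝ) 1) : ‖H t - H s‖ ≤ derivSup H * |t - s| :=
  (convex_Icc (0 : ℝ) 1).norm_image_sub_le_of_norm_derivWithin_le h.differentiable
    (fun x hx => le_ciSup h.bddAbove ⟨x, hx⟩) hs ht

/-- Both sides come from the matrix element of `H t - H s` between the two eigenvectors. Alone it
says nothing when the overlap vanishes, which is where continuity of the path enters. -/
lemma abs_energy_sub_mul_overlap_le (h : IsEigenpath H ψ Δ) {E : ℝ → ℝ}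
    (hE : ∀ s ∈ Icc (0 : ℝ) 1, H s (ψ s) = (E s : ℂ) • ψ s) {s t : ℝ}
    (hs : s ∈ Icc (0 : ℝ) 1) (ht : t ∈ Icc (0 : ℝ) 1) :
    |E t - E s| * ‖inner ℂ (ψ t) (ψ s)‖ ≤ derivSup H * |t - s| := by
  have h1 : inner ℂ (ψ t) ((H t - H s) (ψ s)) = ((E t - E s : ℝ) : ℂ) * inner ℂ (ψ t) (ψ s) := by
    have h2 : inner ℂ (H t (ψ t)) (ψ s) = inner ℂ (ψ t) (H t (ψ s)) := h.symmetric t ht _ _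
    rw [sub_apply, inner_sub_right, ← h2, hE t ht, hE s hs,
      inner_smul_left, inner_smul_right, Complex.conj_ofReal]
    push_cast
    ring
  calc _ = ‖inner ℂ (ψ t) ((H t - H s) (ψ s))‖ := by
        rw [h1, norm_mul, Complex.norm_real, Real.norm_eq_abs]
    _ ≤ ‖ψ t‖ * ‖(H t - H s) (ψ s)‖ := norm_inner_le_norm _ _
    _ ≤ ‖ψ t‖ * (‖H t - H s‖ * ‖ψ s‖) := by gcongr; exact ContinuousLinearMap.le_opNorm _ _
    _ = ‖H t - H s‖ := by rw [h.norm_eq_one t ht, h.norm_eq_one s hs]; ring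
    _ ≤ _ := h.norm_sub_le hs ht

open Filter Topology in
lemma tendsto_overlap (h : IsEigenpath H ψ Δ) {s : ℝ} (hs : s ∈ Icc (0 : ℝ) 1) :
    Tendsto (fun t => ‖inner ℂ (ψ t) (ψ s)‖) (𝓝[Icc (0 : ℝ) 1] s) (𝓝 1) := by
  have h1 : ContinuousWithinAt (fun t => inner ℂ (ψ s) (proj (ψ t) (ψ s))) (Icc (0 : ℝ) 1) s :=
    (((innerSL ℂ (ψ s)).comp (ContinuousLinearMap.apply ℂ V (ψ s))).continuous.comp_continuousOn
      h.continuous) s hs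
  have h2 : ∀ t, ‖inner ℂ (ψ s) (proj (ψ t) (ψ s))‖ = ‖inner ℂ (ψ t) (ψ s)‖ ^ 2 := by
    intro t
    rw [proj, InnerProductSpace.rankOne_apply, inner_smul_right, norm_mul,
      norm_inner_symm (ψ s) (ψ t), sq]
  have h3 := (Real.continuous_sqrt.tendsto _).comp h1.norm.tendsto
  simp only [Function.comp_def, h2, Real.sqrt_sq (norm_nonneg _),
    inner_self_of_norm_eq_one (h.norm_eq_one s hs), norm_one, one_pow,
    Real.sqrt_one] at h3
  exact h3

open Filter Topology in
lemma eventually_abs_energy_sub_le (h : IsEigenpath H ψ Δ) {E : ℝ → ℝ}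
    (hE : ∀ s ∈ Icc (0 : ℝ) 1, H s (ψ s) = (E s : ℂ) • ψ s) {K : ℝ} (hK : derivSup H < K)
    {s : ℝ} (hs : s ∈ Icc (0 : ℝ) 1) :
    ∀ᶠ t in 𝓝[Icc (0 : ℝ) 1] s, |E t - E s| ≤ K * |t - s| := by
  have hM := derivSup_nonneg H
  have hc : derivSup H / K < 1 := (div_lt_one (by linarith)).2 hK
  filter_upwards [(h.tendsto_overlap hs).eventually_const_lt hc, self_mem_nhdsWithin] with t h1 ht
  have h0 : 0 ≤ derivSup H / K := div_nonneg hM (by linarith)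
  have h2 := h.abs_energy_sub_mul_overlap_le hE hs ht
  have h3 : derivSup H ≤ K * ‖inner ℂ (ψ t) (ψ s)‖ := by
    rw [div_lt_iff₀ (by linarith)] at h1; linarith
  refine le_of_mul_le_mul_right ?_ (h0.trans_lt h1)
  calc _ ≤ _ := h2
    _ ≤ K * ‖inner ℂ (ψ t) (ψ s)‖ * |t - s| := by gcongr
    _ = _ := by ring

open Filter Topology in
-- The local Lipschitz bound holds only near each point, so it is globalized by a mean value
-- inequality for slopes.
lemma abs_energy_sub_le_of_le (h : IsEigenpath H ψ Δ) {E : ℝ → ℝ}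
    (hE : ∀ s ∈ Icc (0 : ℝ) 1, H s (ψ s) = (E s : ℂ) • ψ s) {a b : ℝ} (ha : 0 ≤ a)
    (hab : a ≤ b) (hb : b ≤ 1) : |E b - E a| ≤ derivSup H * |b - a| := by
  have hsub : Icc a b ⊆ Icc (0 : ℝ) 1 := Icc_subset_Icc ha hb
  have hcont : ContinuousOn (fun t => E t - E a) (Icc a b) := by
    intro s hs
    refine ContinuousWithinAt.mono ?_ hsub
    refine ContinuousWithinAt.sub ?_ continuousWithinAt_const
    have h1 := h.eventually_abs_energy_sub_le hE (lt_add_one _) (hsub hs)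
    rw [ContinuousWithinAt, tendsto_iff_norm_sub_tendsto_zero]
    refine squeeze_zero' (Eventually.of_forall fun _ => norm_nonneg _) h1 ?_
    have h2 : Continuous fun t : ℝ => (derivSup H + 1) * |t - s| := by fun_prop
    simpa using (h2.tendsto s).mono_left nhdsWithin_le_nhds
  -- The mean value inequality needs a strict margin, hence `K' < K`; letting `K` decrease to
  -- `derivSup H` recovers the sharp constant.
  have key : ∀ K, derivSup H < K → |E b - E a| ≤ K * |b - a| := by
    intro K hK
    obtain ⟨K', hK'1, hK'2⟩ := exists_between hK
    have := image_norm_le_of_liminf_right_slope_norm_lt_deriv_boundary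
      (f := fun t => E t - E a) (f' := fun _ => K') (B := fun t => K * (t - a)) (B' := fun _ => K)
      hcont ?_ (by simp) (by fun_prop) ?_ (fun _ _ _ => hK'2) (right_mem_Icc.2 hab)
    · simpa [abs_of_nonneg (sub_nonneg.2 hab)] using this
    · intro x hx r hr
      refine Eventually.frequently ?_
      have h1 := h.eventually_abs_energy_sub_le hE hK'1 (hsub (Ico_subset_Icc_self hx))
      have h2 : 𝓝[>] x ≤ 𝓝[Icc (0 : ℝ) 1] x :=
        nhdsWithin_le_of_mem (mem_of_superset (Icc_mem_nhdsGT_of_mem hx) hsub)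
      filter_upwards [h2 h1, self_mem_nhdsWithin] with z hz hxz
      have hxz' : 0 < z - x := sub_pos.2 hxz
      refine lt_of_le_of_lt ?_ hr
      rw [slope_def_field, div_le_iff₀ hxz']
      have h3 := abs_sub_abs_le_abs_sub (E z - E a) (E x - E a)
      rw [abs_of_pos hxz', ← sub_sub_sub_cancel_right _ _ (E a)] at hz
      exact h3.trans hz
    · intro x _
      simpa using (((hasDerivAt_id x).sub_const a).const_mul K).hasDerivWithinAt
  refine ge_of_tendsto (f := fun K => K * |b - a|) (x := 𝓝[>] (derivSup H)) ?_
    (eventually_nhdsWithin_of_forall key)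
  have h2 : Continuous fun K : ℝ => K * |b - a| := by fun_prop
  exact (h2.tendsto _).mono_left nhdsWithin_le_nhds

/-- The eigenvalue along the path is Lipschitz with constant `derivSup H`. -/
lemma abs_energy_sub_le (h : IsEigenpath H ψ Δ) {E : ℝ → ℝ}
    (hE : ∀ s ∈ Icc (0 : ℝ) 1, H s (ψ s) = (E s : ℂ) • ψ s) {s t : ℝ}
    (hs : s ∈ Icc (0 : ℝ) 1) (ht : t ∈ Icc (0 : ℝ) 1) :
    |E t - E s| ≤ derivSup H * |t - s| := by
  rcases le_total s t with hst | hst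
  · exact h.abs_energy_sub_le_of_le hE hs.1 hst ht.2
  · rw [abs_sub_comm (E t), abs_sub_comm t]
    exact h.abs_energy_sub_le_of_le hE ht.1 hst hs.2

variable [FiniteDimensional ℂ V]

/-- Nearby eigenstates of the path are close up to a phase. -/
lemma norm_sub_inner_smul_le (h : IsEigenpath H ψ Δ) (hΔ : 0 < Δ) {s t : ℝ}
    (hs : s ∈ Icc (0 : ℝ) 1) (ht : t ∈ Icc (0 : ℝ) 1) (hst : derivSup H * |t - s| ≤ Δ / 2) :
    ‖ψ t - inner ℂ (ψ s) (ψ t) • ψ s‖ ≤ 2 / Δ * (derivSup H * |t - s|) := by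
  choose! E hE hrank hgap using h.eigenstate
  have hEE := h.abs_energy_sub_le hE hs ht
  have hw : ‖H s (ψ t) - (E t : ℂ) • ψ t‖ ≤ derivSup H * |t - s| := by
    rw [← hE t ht, ← sub_apply, abs_sub_comm]
    refine (ContinuousLinearMap.le_opNorm _ _).trans ?_
    rw [h.norm_eq_one t ht, mul_one]
    exact h.norm_sub_le ht hs
  have hmain := PhaseRandomization.norm_sub_inner_smul_le (h.symmetric s hs) (h.norm_eq_one s hs)
    (hE s hs) (hrank s hs) (u := ψ t) (w := H s (ψ t) - (E t : ℂ) • ψ t) (η := 2 / Δ)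
    (by positivity) ?_
  · exact hmain.trans (by gcongr)
  · intro φ l hφ hl hlE
    have h1 : inner ℂ φ (H s (ψ t) - (E t : ℂ) • ψ t) = ((l - E t : ℝ) : ℂ) * inner ℂ φ (ψ t) := by
      have h2 : inner ℂ (H s φ) (ψ t) = inner ℂ φ (H s (ψ t)) := h.symmetric s hs _ _
      rw [inner_sub_right, ← h2, hφ, inner_smul_left, inner_smul_right, Complex.conj_ofReal]
      push_cast
      ring
    rw [h1, norm_mul, Complex.norm_real, Real.norm_eq_abs, ← mul_assoc]
    have h3 := hgap s hs l hl hlE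
    -- `E t` has moved by at most `Δ / 2` from `E s`, so half of the gap survives.
    have h4 : Δ / 2 ≤ |l - E t| := by
      have h5 := abs_sub_le l (E t) (E s)
      linarith
    have h5 : 1 ≤ 2 / Δ * |l - E t| := by
      rw [div_mul_eq_mul_div, le_div_iff₀ hΔ]; linarith
    exact le_mul_of_one_le_left (norm_nonneg _) h5

/-! ### Accumulated error of the method -/

/-- Invariant of the randomization method. -/
lemma stateAfter_invariant (h : IsEigenpath H ψ Δ) (hΔ : 0 < Δ) {μ : Measure ℝ}
    [IsProbabilityMeasure μ] {η : ℝ} (hη : 0 ≤ η) (hμ : ∀ ω, Δ ≤ |ω| → ‖charFun μ ω‖ ≤ η)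
    {q : ℕ} (hq : derivSup H / q ≤ Δ / 2) {β : ℝ} (hβ : β = 2 / Δ * (derivSup H / q)) :
    ∀ k ≤ q, (stateAfter H μ q (proj (ψ 0)) k).IsPositive ∧
      ‖stateAfter H μ q (proj (ψ 0)) k‖ ≤ 1 ∧
      ‖stateAfter H μ q (proj (ψ 0)) k (ψ (k / q)) - inner ℂ (ψ (k / q))
        (stateAfter H μ q (proj (ψ 0)) k (ψ (k / q))) • ψ (k / q)‖ ≤ η ∧
      1 - k * (β ^ 2 + 2 * β * η)
        ≤ fidelity (ψ (k / q)) (stateAfter H μ q (proj (ψ 0)) k) := by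
  intro k
  induction k with
  | zero =>
    intro _
    have h0 := h.norm_eq_one 0 (by simp)
    have h1 := inner_self_of_norm_eq_one h0
    have h2 : proj (ψ 0) (ψ 0) = ψ 0 := by
      rw [proj, InnerProductSpace.rankOne_apply, h1, one_smul]
    refine ⟨?_, ?_, ?_, ?_⟩
    · exact InnerProductSpace.isPositive_rankOne_self _
    · simp [stateAfter, proj, h0]
    · simpa [stateAfter, h2, h0] using hη
    · simp [stateAfter, fidelity, h2, h0]
  | succ k ih =>
    intro hk
    obtain ⟨hpos, hnorm, hdef, hfid⟩ := ih (by omega)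
    set ρ := stateAfter H μ q (proj (ψ 0)) k with hρ
    have hq0 : (0 : ℝ) < q := by exact_mod_cast (by omega : 0 < q)
    have hs : (k / q : ℝ) ∈ Icc (0 : ℝ) 1 :=
      ⟨by positivity, (div_le_one hq0).2 (by exact_mod_cast (by omega : k ≤ q))⟩
    have ht : (((k + 1 : ℕ) : ℝ) / q : ℝ) ∈ Icc (0 : ℝ) 1 :=
      ⟨by positivity, (div_le_one hq0).2 (by exact_mod_cast hk)⟩
    have hdist : derivSup H * |((k + 1 : ℕ) : ℝ) / q - k / q| = derivSup H / q := by
      rw [← sub_div, Nat.cast_succ, add_sub_cancel_left, abs_of_pos (by positivity), mul_one_div]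
    have hov := h.norm_sub_inner_smul_le hΔ hs ht (by rw [hdist]; exact hq)
    rw [hdist, ← hβ] at hov
    have hstep := fidelity_sub_le (h.norm_eq_one _ hs) (h.norm_eq_one _ ht) hpos hnorm hdef hov
    set t : ℝ := ((k + 1 : ℕ) : ℝ) / q with ht'
    have hst : stateAfter H μ q (proj (ψ 0)) (k + 1) = randomizedEvolution (H t) μ ρ := rfl
    rw [hst]
    have hsymm := h.symmetric t ht
    obtain ⟨E, hE, hrank, hgap⟩ := h.eigenstate t ht
    refine ⟨isPositive_randomizedEvolution hsymm μ hpos,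
      (norm_randomizedEvolution_le hsymm μ ρ).trans hnorm, ?_, ?_⟩
    · refine (PhaseRandomization.norm_sub_inner_smul_le hsymm (h.norm_eq_one t ht) hE hrank
        (w := ρ (ψ t)) hη ?_).trans ?_
      · intro φ l hφ hl hlE
        rw [inner_randomizedEvolution_of_eigenvectors hsymm μ ρ hφ hE, norm_mul]
        gcongr
        exact hμ _ (by rw [abs_sub_comm]; exact hgap l hl hlE)
      · have h1 : ‖ρ (ψ t)‖ ≤ 1 := by
          refine (ρ.le_opNorm _).trans ?_
          rw [h.norm_eq_one t ht, mul_one]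
          exact hnorm
        exact mul_le_of_le_one_right hη h1
    -- The step itself costs no fidelity; all loss comes from replacing the reference state in
    -- `hstep`.
    · have h1 : fidelity (ψ t) (randomizedEvolution (H t) μ ρ) = fidelity (ψ t) ρ := by
        rw [fidelity, inner_randomizedEvolution_of_eigenvectors hsymm μ ρ hE hE]
        simp [fidelity]
      rw [h1]
      push_cast
      linarith

/-- Fidelity of the output of the randomization method. -/
lemma le_fidelity_output (h : IsEigenpath H ψ Δ) (hΔ : 0 < Δ) {μ : Measure ℝ}
    [IsProbabilityMeasure μ] {η : ℝ} (hη : 0 ≤ η) (hμ : ∀ ω, Δ ≤ |ω| → ‖charFun μ ω‖ ≤ η)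
    {q : ℕ} (hq0 : 0 < q) (hq : derivSup H / q ≤ Δ / 2) :
    1 - q * ((2 / Δ * (derivSup H / q)) ^ 2 + 2 * (2 / Δ * (derivSup H / q)) * η)
      ≤ fidelity (ψ 1) (output H μ q (ψ 0)) := by
  have h1 := (h.stateAfter_invariant hΔ hη hμ hq rfl q le_rfl).2.2.2
  rwa [div_self (by positivity)] at h1

/-- Fidelity of the initial state with the final one. -/
lemma le_fidelity_output_zero (h : IsEigenpath H ψ Δ) (hΔ : 0 < Δ) (μ : Measure ℝ)
    (hM : derivSup H ≤ Δ / 2) :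
    1 - (2 / Δ * derivSup H) ^ 2 ≤ fidelity (ψ 1) (output H μ 0 (ψ 0)) := by
  have h0 : (0 : ℝ) ∈ Icc (0 : ℝ) 1 := by simp
  have h1 : (1 : ℝ) ∈ Icc (0 : ℝ) 1 := by simp
  have hov := h.norm_sub_inner_smul_le hΔ h0 h1 (by simpa using hM)
  have hψψ := inner_self_of_norm_eq_one (h.norm_eq_one 0 h0)
  have h2 : proj (ψ 0) (ψ 0) = ψ 0 := by
    rw [proj, InnerProductSpace.rankOne_apply, hψψ, one_smul]
  have h3 := fidelity_sub_le (h.norm_eq_one 0 h0) (h.norm_eq_one 1 h1) (ρ := proj (ψ 0)) (η := 0)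
    (InnerProductSpace.isPositive_rankOne_self _) (by simp [proj, h.norm_eq_one 0 h0])
    (by simp [h2, h.norm_eq_one 0 h0]) hov
  have h4 : fidelity (ψ 0) (proj (ψ 0)) = 1 := by simp [fidelity, h2, h.norm_eq_one 0 h0]
  simpa [h4, output, stateAfter] using h3

end IsEigenpath

end PhaseRandomization

/-! ### Laws of the evolution time -/

namespace PhaseRandomization

open FourierTransform SchwartzMap in
/-- Characteristic function of the density `‖𝓕 f‖²`: the autocorrelation of `f`. -/
lemma integral_norm_sq_fourier_mul_exp (f : 𝓢(ℝ, ℂ)) (ω : ℝ) :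
    ∫ t : ℝ, ((‖𝓕 f t‖ ^ 2 : ℝ) : ℂ) * Complex.exp (ω * t * Complex.I)
      = ∫ x : ℝ, inner ℂ (f x) (f (x + ω / (2 * Real.pi))) := by
  -- The `2π` comes from the normalization of `𝓕`: translating `f` by `a` multiplies `𝓕 f` by
  -- `e^{iωt}`, and Plancherel then gives the autocorrelation.
  set a : ℝ := ω / (2 * Real.pi) with ha
  have h1 : ∀ t : ℝ, 𝓕 (SchwartzMap.compSubConstCLM ℂ (-a) f) t
      = Complex.exp (ω * t * Complex.I) * 𝓕 f t := by
    intro t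
    have h2 := congrFun (VectorFourier.fourierIntegral_comp_add_right Real.fourierChar volume
      (innerₗ ℝ) (f : ℝ → ℂ) a) t
    have h3 : ((SchwartzMap.compSubConstCLM ℂ (-a) f : 𝓢(ℝ, ℂ)) : ℝ → ℂ)
        = (f : ℝ → ℂ) ∘ fun v => v + a := by
      ext x; simp [SchwartzMap.compSubConstCLM_apply]
    rw [SchwartzMap.fourier_coe, SchwartzMap.fourier_coe, h3]
    refine h2.trans ?_
    rw [Circle.smul_def, Real.fourierChar_apply, smul_eq_mul]
    congr 2
    have : (2 * Real.pi * (innerₗ ℝ a t) : ℝ) = ω * t := by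
      simp [ha]
      field_simp
    rw [this]
    push_cast
    rfl
  have h4 := SchwartzMap.integral_inner_fourier_fourier f (SchwartzMap.compSubConstCLM ℂ (-a) f)
  simp only [SchwartzMap.compSubConstCLM_apply, sub_neg_eq_add] at h4
  rw [← h4]
  refine integral_congr_ae (Filter.Eventually.of_forall fun t => ?_)
  simp only
  rw [h1, ← smul_eq_mul (Complex.exp _), inner_smul_right, inner_self_eq_norm_sq_to_K]
  push_cast
  exact mul_comm _ _

open FourierTransform SchwartzMap in
/-- A probability law with finite first moment whose characteristic function vanishes outside
`(-1, 1)`. -/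
lemma exists_law_charFun_eq_zero :
    ∃ μ : Measure ℝ, IsProbabilityMeasure μ ∧ ∫⁻ t : ℝ, ENNReal.ofReal |t| ∂μ ≠ ∞ ∧
      ∀ ω : ℝ, 1 ≤ |ω| → charFun μ ω = 0 := by
  -- The bump vanishes for `|x| ≥ 1/20`, and `|ω| ≥ 1` shifts it by at least `1/(2π) > 1/10`, so the
  -- translates do not overlap.
  let b : ContDiffBump (0 : ℝ) := ⟨1 / 40, 1 / 20, by norm_num, by norm_num⟩
  have hsupp : HasCompactSupport (fun x => (b x : ℂ)) :=
    b.hasCompactSupport.comp_left (g := ((↑) : ℝ → ℂ)) Complex.ofReal_zero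
  let f : 𝓢(ℝ, ℂ) := hsupp.toSchwartzMap (Complex.ofRealCLM.contDiff.comp b.contDiff)
  have hf : ∀ x, f x = (b x : ℂ) := fun x => rfl
  have hZ : 0 < ∫ t : ℝ, ‖𝓕 f t‖ ^ 2 := by
    rw [SchwartzMap.integral_norm_sq_fourier]
    refine Continuous.integral_pos_of_hasCompactSupport_nonneg_nonzero (x := 0)
      (f.continuous.norm.pow 2) ?_ (fun x => by positivity) ?_
    · exact HasCompactSupport.comp_left (f := f) (g := fun z : ℂ => ‖z‖ ^ 2) hsupp (by simp)
    · have : b 0 = 1 := b.one_of_mem_closedBall (by simp [b])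
      simp [hf, this]
  set Z := ∫ t : ℝ, ‖𝓕 f t‖ ^ 2 with hZdef
  have hcont : Continuous fun t => ‖𝓕 f t‖ ^ 2 / Z := ((𝓕 f).continuous.norm.pow 2).div_const _
  have hbound : ∃ B : ℝ, 0 ≤ B ∧ ∀ t, ‖𝓕 f t‖ ≤ B := by
    obtain ⟨B, hB⟩ := (𝓕 f).decay 0 0
    exact ⟨B, hB.1.le, fun t => by simpa using hB.2 t⟩
  obtain ⟨B, hB0, hB⟩ := hbound
  have hint : Integrable (fun t : ℝ => ‖𝓕 f t‖ ^ 2 / Z) := by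
    refine Integrable.div_const ?_ _
    -- A nonintegrable function would have integral 0 by convention, contradicting `Z > 0`.
    by_contra h
    exact hZ.ne' (integral_undef h)
  have hmeas : Measurable fun t => ENNReal.ofReal (‖𝓕 f t‖ ^ 2 / Z) :=
    ENNReal.measurable_ofReal.comp hcont.measurable
  refine ⟨volume.withDensity fun t => ENNReal.ofReal (‖𝓕 f t‖ ^ 2 / Z), ⟨?_⟩, ?_, ?_⟩
  · rw [withDensity_apply _ MeasurableSet.univ, setLIntegral_univ,
      ← ofReal_integral_eq_lintegral_ofReal hint
        (Filter.Eventually.of_forall fun t => by positivity), integral_div, ← hZdef,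
      div_self hZ.ne', ENNReal.ofReal_one]
  · rw [lintegral_withDensity_eq_lintegral_mul _ hmeas (by fun_prop)]
    have h1 : Integrable (fun t : ℝ => ‖𝓕 f t‖ ^ 2 / Z * |t|) := by
      have h2 := ((𝓕 f).integrable_pow_mul volume 1).const_mul (B / Z)
      refine h2.mono' (hcont.mul continuous_abs).aestronglyMeasurable
        (Filter.Eventually.of_forall fun t => ?_)
      rw [Real.norm_eq_abs, abs_of_nonneg (by positivity), pow_one, Real.norm_eq_abs]
      calc ‖𝓕 f t‖ ^ 2 / Z * |t| = ‖𝓕 f t‖ * ‖𝓕 f t‖ / Z * |t| := by ring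
        _ ≤ B * ‖𝓕 f t‖ / Z * |t| := by gcongr; exact hB t
        _ = B / Z * (|t| * ‖𝓕 f t‖) := by ring
    have h3 := h1.lintegral_lt_top
    simp only [Pi.mul_apply]
    refine (lt_of_eq_of_lt (lintegral_congr fun t => ?_) h3).ne
    rw [ENNReal.ofReal_mul (by positivity)]
  · intro ω hω
    rw [charFun_apply_real, integral_withDensity_eq_integral_toReal_smul hmeas
      (Filter.Eventually.of_forall fun t => ENNReal.ofReal_lt_top)]
    have h1 : ∀ t : ℝ, (ENNReal.ofReal (‖𝓕 f t‖ ^ 2 / Z)).toReal • Complex.exp (ω * t * Complex.I)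
        = (((‖𝓕 f t‖ ^ 2 : ℝ) : ℂ) * Complex.exp (ω * t * Complex.I)) / Z := by
      intro t
      rw [ENNReal.toReal_ofReal (by positivity), Complex.real_smul]
      push_cast
      ring
    rw [integral_congr_ae (Filter.Eventually.of_forall h1), integral_div,
      integral_norm_sq_fourier_mul_exp]
    have h2 : ∀ x : ℝ, inner ℂ (f x) (f (x + ω / (2 * Real.pi))) = 0 := by
      intro x
      by_cases hx : |x| < 1 / 20
      · have hy : 1 / 20 ≤ |x + ω / (2 * Real.pi)| := by
          have h3 : 1 / 10 ≤ |ω / (2 * Real.pi)| := by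
            rw [abs_div, abs_of_pos (by positivity : 0 < 2 * Real.pi),
              div_le_div_iff₀ (by norm_num) (by positivity)]
            linarith [Real.pi_lt_d2]
          have h4 := abs_sub_abs_le_abs_sub (ω / (2 * Real.pi)) (-x)
          rw [abs_neg, sub_neg_eq_add, add_comm] at h4
          linarith
        have : b (x + ω / (2 * Real.pi)) = 0 := b.zero_of_le_dist (by simpa [b] using hy)
        simp [hf, this]
      · have : b x = 0 := b.zero_of_le_dist (by simpa [b] using hx)
        simp [hf, this]
    rw [integral_congr_ae (Filter.Eventually.of_forall h2), integral_zero, zero_div]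

/-- The uniform law on `(0, 4]`. -/
lemma exists_law_uniform :
    ∃ μ : Measure ℝ, IsProbabilityMeasure μ ∧ μ (Iio 0) = 0 ∧
      ∫⁻ t : ℝ, ENNReal.ofReal |t| ∂μ ≤ 4 ∧
      ∀ ω : ℝ, 1 ≤ |ω| → ‖charFun μ ω‖ ≤ 1 / 2 := by
  have hprob : ((ENNReal.ofReal (1 / 4)) • volume.restrict (Ioc (0 : ℝ) 4)) univ = 1 := by
    rw [Measure.smul_apply, Measure.restrict_apply_univ, Real.volume_Ioc, smul_eq_mul,
      ← ENNReal.ofReal_mul (by norm_num)]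
    norm_num
  refine ⟨(ENNReal.ofReal (1 / 4)) • volume.restrict (Ioc (0 : ℝ) 4), ⟨hprob⟩, ?_, ?_, ?_⟩
  · have : Iio (0 : ℝ) ∩ Ioc 0 4 = ∅ := by
      ext x; simp only [mem_inter_iff, mem_Iio, mem_Ioc, mem_empty_iff_false]; grind
    rw [Measure.smul_apply, Measure.restrict_apply measurableSet_Iio, this]
    simp
  · calc _ ≤ ∫⁻ _t : ℝ, 4 ∂((ENNReal.ofReal (1 / 4)) • volume.restrict (Ioc (0 : ℝ) 4)) := by
          refine lintegral_mono_ae (Measure.ae_smul_measure ?_ _)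
          filter_upwards [ae_restrict_mem measurableSet_Ioc] with t ht
          rw [abs_of_pos ht.1]
          exact ENNReal.ofReal_le_of_le_toReal (by simpa using ht.2)
      _ = 4 := by rw [lintegral_const, hprob, mul_one]
  · intro ω hω
    have hω0 : ω ≠ 0 := by rintro rfl; norm_num at hω
    have hc : (ω * Complex.I : ℂ) ≠ 0 := by simp [hω0]
    have h1 : ∫ t in (0 : ℝ)..4, Complex.exp (ω * t * Complex.I)
        = (Complex.exp ((ω * 4 : ℝ) * Complex.I) - 1) / (ω * Complex.I) := by
      have h2 := integral_exp_mul_complex (a := 0) (b := 4) hc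
      have h3 : ∀ t : ℝ, (ω * t * Complex.I : ℂ) = ω * Complex.I * t := fun t => by ring
      simp_rw [h3]
      rw [h2]
      push_cast
      congr 2
      · congr 1; ring
      · simp
    rw [charFun_apply_real, integral_smul_measure, ← intervalIntegral.integral_of_le (by norm_num),
      h1, norm_smul, norm_div, norm_mul, Complex.norm_I, mul_one, Complex.norm_real,
      Real.norm_eq_abs ω, ENNReal.toReal_ofReal (by norm_num)]
    have h4 : ‖Complex.exp ((ω * 4 : ℝ) * Complex.I) - 1‖ ≤ 2 := by
      refine (norm_sub_le _ _).trans ?_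
      rw [Complex.norm_exp_ofReal_mul_I, norm_one]
      norm_num
    -- With the density `1/4` this yields the bound `1/2`; the length 4 is chosen for it.
    have h5 : ‖Complex.exp ((ω * 4 : ℝ) * Complex.I) - 1‖ / |ω| ≤ 2 := by
      rw [div_le_iff₀ (by linarith)]; linarith
    rw [Real.norm_of_nonneg (by norm_num)]
    linarith

/-- Nonnegative laws with characteristic function exponentially small outside `(-1, 1)`. -/
lemma exists_law_nonneg (n : ℕ) :
    ∃ μ : Measure ℝ, IsProbabilityMeasure μ ∧ μ (Iio 0) = 0 ∧
      ∫⁻ t : ℝ, ENNReal.ofReal |t| ∂μ ≤ n * 4 ∧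
      ∀ ω : ℝ, 1 ≤ |ω| → ‖charFun μ ω‖ ≤ (1 / 2) ^ n := by
  induction n with
  | zero =>
    refine ⟨Measure.dirac 0, inferInstance, ?_, ?_, ?_⟩
    · simp
    · simp
    · intro ω _
      simp
  | succ n ih =>
    obtain ⟨μ, hμ, hμ0, hμ1, hμ2⟩ := ih
    obtain ⟨ν, hν, hν0, hν1, hν2⟩ := exists_law_uniform
    refine ⟨Measure.conv μ ν, inferInstance, ?_, ?_, ?_⟩
    · have h : ∀ᵐ t ∂(Measure.conv μ ν), 0 ≤ t := by
        rw [Measure.conv, ae_map_iff (by fun_prop) measurableSet_Ici]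
        have h1 : ∀ᵐ p ∂(μ.prod ν), 0 ≤ p.1 :=
          Measure.quasiMeasurePreserving_fst.ae (ae_iff.2 (by simpa [Iio] using hμ0))
        have h2 : ∀ᵐ p ∂(μ.prod ν), 0 ≤ p.2 :=
          Measure.quasiMeasurePreserving_snd.ae (ae_iff.2 (by simpa [Iio] using hν0))
        filter_upwards [h1, h2] with p hp1 hp2 using add_nonneg hp1 hp2
      simpa [ae_iff, Iio] using h
    · rw [Measure.lintegral_conv (by fun_prop)]
      calc _ ≤ ∫⁻ x, ∫⁻ y, (ENNReal.ofReal |x| + ENNReal.ofReal |y|) ∂ν ∂μ := by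
            refine lintegral_mono fun x => lintegral_mono fun y => ?_
            rw [← ENNReal.ofReal_add (abs_nonneg _) (abs_nonneg _)]
            exact ENNReal.ofReal_le_ofReal (abs_add_le _ _)
        _ = ∫⁻ x, ENNReal.ofReal |x| ∂μ + ∫⁻ y, ENNReal.ofReal |y| ∂ν := by
            simp_rw [lintegral_add_left measurable_const, lintegral_const, measure_univ, mul_one]
            rw [lintegral_add_right _ measurable_const, lintegral_const, measure_univ, mul_one]
        _ ≤ n * 4 + 4 := add_le_add hμ1 hν1
        _ = (n + 1 : ℕ) * 4 := by push_cast; ring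
    · intro ω hω
      rw [charFun_conv, norm_mul, pow_succ]
      gcongr
      exacts [hμ2 ω hω, hν2 ω hω]

lemma lintegral_abs_map_inv_mul (μ : Measure ℝ) {Δ : ℝ} (hΔ : 0 < Δ) :
    ∫⁻ t : ℝ, ENNReal.ofReal |t| ∂(μ.map (Δ⁻¹ * ·))
      = ENNReal.ofReal Δ⁻¹ * ∫⁻ t : ℝ, ENNReal.ofReal |t| ∂μ := by
  rw [lintegral_map (by fun_prop) (by fun_prop), ← lintegral_const_mul _ (by fun_prop)]
  refine lintegral_congr fun t => ?_
  rw [abs_mul, ENNReal.ofReal_mul (abs_nonneg _), abs_of_pos (inv_pos.2 hΔ)]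

lemma one_le_abs_inv_mul {Δ ω : ℝ} (hΔ : 0 < Δ) (hω : Δ ≤ |ω|) : 1 ≤ |Δ⁻¹ * ω| := by
  rw [abs_mul, abs_of_pos (inv_pos.2 hΔ), inv_mul_eq_div, le_div_iff₀ hΔ, one_mul]
  exact hω

/-- Rescaling time by `Δ⁻¹` turns the unit gap into `Δ`. The form `≤ 0` is the hypothesis of the
error bound with `η = 0`. -/
lemma exists_law_charFun_eq_zero_of_gap :
    ∃ C : ℝ, 0 ≤ C ∧ ∀ Δ : ℝ, 0 < Δ → ∃ μ : Measure ℝ, IsProbabilityMeasure μ ∧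
      ∫⁻ t : ℝ, ENNReal.ofReal |t| ∂μ ≤ ENNReal.ofReal (C / Δ) ∧
      ∀ ω : ℝ, Δ ≤ |ω| → ‖charFun μ ω‖ ≤ 0 := by
  obtain ⟨μ, hμ, hμ1, hμ2⟩ := exists_law_charFun_eq_zero
  refine ⟨(∫⁻ t : ℝ, ENNReal.ofReal |t| ∂μ).toReal, ENNReal.toReal_nonneg, fun Δ hΔ => ⟨μ.map (Δ⁻¹ * ·),
    Measure.isProbabilityMeasure_map (by fun_prop), ?_, fun ω hω => ?_⟩⟩
  · rw [lintegral_abs_map_inv_mul μ hΔ, div_eq_inv_mul, ENNReal.ofReal_mul (by positivity),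
      ENNReal.ofReal_toReal hμ1]
  · rw [charFun_map_mul, hμ2 _ (one_le_abs_inv_mul hΔ hω), norm_zero]

lemma exists_law_nonneg_of_gap {Δ : ℝ} (hΔ : 0 < Δ) (n : ℕ) :
    ∃ μ : Measure ℝ, IsProbabilityMeasure μ ∧ μ (Iio 0) = 0 ∧
      ∫⁻ t : ℝ, ENNReal.ofReal |t| ∂μ ≤ ENNReal.ofReal (n * 4 / Δ) ∧
      ∀ ω : ℝ, Δ ≤ |ω| → ‖charFun μ ω‖ ≤ (1 / 2) ^ n := by
  obtain ⟨μ, hμ, hμ0, hμ1, hμ2⟩ := exists_law_nonneg n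
  refine ⟨μ.map (Δ⁻¹ * ·), Measure.isProbabilityMeasure_map (by fun_prop), ?_, ?_, fun ω hω => ?_⟩
  · have : (Δ⁻¹ * ·) ⁻¹' Iio (0 : ℝ) = Iio 0 := by
      ext x; simp [hΔ]
    rw [Measure.map_apply (by fun_prop) measurableSet_Iio, this, hμ0]
  · rw [lintegral_abs_map_inv_mul μ hΔ, div_eq_inv_mul, ENNReal.ofReal_mul (by positivity)]
    gcongr
    rw [ENNReal.ofReal_mul (by positivity), ENNReal.ofReal_natCast]
    simpa using hμ1
  · rw [charFun_map_mul]
    exact hμ2 _ (one_le_abs_inv_mul hΔ hω)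

/-- Number of convolution factors needed for a given suppression. -/
lemma exists_nat_half_pow_le {ε : ℝ} (hε : 0 < ε) (hε1 : ε < 1) {x : ℝ} (hx : ε / 2 ≤ x) :
    ∃ n : ℕ, (1 / 2 : ℝ) ^ n ≤ ε / (8 * x) ∧
      (n : ℝ) ≤ (2 * Real.log (8 / ε) + 3) * max 1 (Real.log x) := by
  have hx0 : 0 < x := by linarith
  have h8 : 1 ≤ 8 / ε := by rw [le_div_iff₀ hε]; linarith
  have hlog8 : 0 ≤ Real.log (8 / ε) := Real.log_nonneg h8
  have hy : 1 ≤ 8 / ε * x := by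
    rw [div_mul_eq_mul_div, le_div_iff₀ hε]; linarith
  have hlog : Real.log (8 / ε * x) = Real.log (8 / ε) + Real.log x :=
    Real.log_mul (by positivity) hx0.ne'
  have hlog0 := Real.log_nonneg hy
  -- The factor 2 compensates for `log 2 ≥ 1/2`; below, the 3 is 2 for `log x` plus 1 for the
  -- ceiling.
  refine ⟨⌈2 * Real.log (8 / ε * x)⌉₊, ?_, ?_⟩
  · have h1 := Nat.le_ceil (2 * Real.log (8 / ε * x))
    set n := ⌈2 * Real.log (8 / ε * x)⌉₊
    have h2 : 8 / ε * x ≤ 2 ^ n := by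
      rw [← Real.log_le_log_iff (by positivity) (by positivity), Real.log_pow]
      have h3 : (1 / 2 : ℝ) ≤ Real.log 2 := by linarith [Real.log_two_gt_d9]
      have h4 : (n : ℝ) * (1 / 2) ≤ n * Real.log 2 := by gcongr
      linarith
    rw [one_div, inv_pow]
    have h5 : ε / (8 * x) = (8 / ε * x)⁻¹ := by field_simp
    rw [h5]
    exact inv_anti₀ (by positivity) h2
  · refine (Nat.ceil_lt_add_one (by positivity)).le.trans ?_
    have h1 := le_max_left 1 (Real.log x)
    have h2 := le_max_right 1 (Real.log x)
    set L := max 1 (Real.log x)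
    rw [hlog]
    nlinarith

end PhaseRandomization

/-! ### Choice of parameters and conclusion -/

namespace PhaseRandomization

lemma averageCost_le {q : ℕ} {μ : Measure ℝ} {m a : ℝ}
    (hm : ∫⁻ t : ℝ, ENNReal.ofReal |t| ∂μ ≤ ENNReal.ofReal m) (h : q * m ≤ a) :
    averageCost q μ ≤ ENNReal.ofReal a := by
  refine le_trans ?_ (ENNReal.ofReal_le_ofReal h)
  rw [averageCost, ENNReal.ofReal_mul (by positivity), ENNReal.ofReal_natCast]
  gcongr

/-- Sufficient conditions on the number of steps and the time law for error at most `ε`. -/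
lemma IsEigenpath.one_sub_le_fidelity_output {V : Type*} [NormedAddCommGroup V]
    [InnerProductSpace ℂ V] [FiniteDimensional ℂ V] {H : ℝ → V →L[ℂ] V} {ψ : ℝ → V}
    {Δ ε η : ℝ} (h : IsEigenpath H ψ Δ) (hΔ : 0 < Δ) (hε : 0 < ε)
    (hx : ε < 4 * (derivSup H / Δ) ^ 2) (hx' : ε / 2 ≤ derivSup H / Δ) {μ : Measure ℝ}
    [IsProbabilityMeasure μ] (hη : 0 ≤ η) (hηε : η ≤ ε / (8 * (derivSup H / Δ)))
    (hμ : ∀ ω, Δ ≤ |ω| → ‖charFun μ ω‖ ≤ η) {q : ℕ} (hq : 8 * (derivSup H / Δ) ^ 2 / ε ≤ q) :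
    1 - ε ≤ fidelity (ψ 1) (output H μ q (ψ 0)) := by
  set x := derivSup H / Δ with hxdef
  have hx0 : 0 < x := by linarith
  have hM : derivSup H = x * Δ := by rw [hxdef, div_mul_cancel₀ _ hΔ.ne']
  have hqx : 8 * x ^ 2 ≤ q * ε := (div_le_iff₀ hε).1 hq
  have hq0 : (0 : ℝ) < q := lt_of_lt_of_le (by positivity) hq
  have hstep : derivSup H / q ≤ Δ / 2 := by
    have h2 : 2 * x ≤ q := by
      by_contra hlt
      push Not at hlt
      nlinarith [mul_lt_mul_of_pos_right hlt hε]
    rw [div_le_iff₀ hq0, hM]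
    nlinarith
  refine le_trans ?_ (h.le_fidelity_output hΔ hη hμ (by exact_mod_cast hq0) hstep)
  -- The transport loss and the coherence loss each receive half of `ε`.
  have h1 : (q : ℝ) * ((2 / Δ * (derivSup H / q)) ^ 2 + 2 * (2 / Δ * (derivSup H / q)) * η)
      = 4 * x ^ 2 / q + 4 * x * η := by
    rw [hM]; field_simp; ring
  have h2 : 4 * x ^ 2 / q ≤ ε / 2 := by
    rw [div_le_iff₀ hq0]; linarith
  have h3 : 4 * x * η ≤ ε / 2 := by
    rw [le_div_iff₀ (by positivity)] at hηε; linarith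
  rw [h1]
  linarith

end PhaseRandomization

open PhaseRandomization in
theorem mainTheorem5 (ε : ℝ) (hε : 0 < ε) (hε1 : ε < 1) :
    ∃ C : ℝ, 0 < C ∧ ∀ M Δ : ℝ, 0 ≤ M → 0 < Δ → ∀ α : ℕ, α = 0 ∨ α = 1 →
      ∃ (q : ℕ) (μ : MeasureTheory.Measure ℝ),
        MeasureTheory.IsProbabilityMeasure μ ∧
        (α = 1 → μ (Set.Iio 0) = 0) ∧
        PhaseRandomization.averageCost q μ ≤
          ENNReal.ofReal (C * (M ^ 2 / Δ ^ 3 * (max 1 (Real.log (M / Δ))) ^ α)) ∧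
        ∀ (V : Type*) [NormedAddCommGroup V] [InnerProductSpace ℂ V] [FiniteDimensional ℂ V]
          (H : ℝ → V →L[ℂ] V) (ψ : ℝ → V),
          PhaseRandomization.IsEigenpath H ψ Δ →
          PhaseRandomization.derivSup H = M →
          1 - ε ≤ PhaseRandomization.fidelity (ψ 1)
            (PhaseRandomization.output H μ q (ψ 0)) := by
  obtain ⟨C₀, hC₀, hlaw⟩ := exists_law_charFun_eq_zero_of_gap
  have hlog8 : 0 ≤ Real.log (8 / ε) :=
    Real.log_nonneg (by rw [le_div_iff₀ hε]; linarith)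
  set C₁ := 2 * Real.log (8 / ε) + 3 with hC₁
  have hC₁0 : 0 < C₁ := by positivity
  -- `12 / ε` bounds `q / x²`; `C₀` and `4 * C₁` come from the mean times for `α = 0` and `α = 1`.
  refine ⟨12 / ε * (C₀ + 4 * C₁), by positivity, fun M Δ hM hΔ α hα => ?_⟩
  set x := M / Δ with hx
  have hx0 : 0 ≤ x := div_nonneg hM hΔ.le
  have hMx : M = x * Δ := by rw [hx, div_mul_cancel₀ _ hΔ.ne']
  -- For small `x` the endpoints are already close, so zero steps suffice. Even one step could
  -- exceed a budget proportional to `x²`; otherwise `4x²/ε > 1` absorbs the rounding of `q`.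
  by_cases hsmall : 4 * x ^ 2 ≤ ε
  · refine ⟨0, MeasureTheory.Measure.dirac 0, inferInstance, fun _ => by simp,
      by simp [averageCost], fun V _ _ _ H ψ h hHM => ?_⟩
    have hx2 : x ≤ 1 / 2 := by nlinarith
    refine le_trans ?_ (h.le_fidelity_output_zero hΔ _ (by rw [hHM, hMx]; nlinarith))
    have : 2 / Δ * derivSup H = 2 * x := by rw [hHM, hMx]; field_simp
    rw [this]
    linarith
  · push Not at hsmall
    have hxε : ε / 2 ≤ x := by nlinarith
    have hxpos : 0 < x := by linarith
    have hq1 := Nat.le_ceil (8 * x ^ 2 / ε)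
    have hq2 : (⌈8 * x ^ 2 / ε⌉₊ : ℝ) ≤ 12 / ε * x ^ 2 := by
      refine (Nat.ceil_lt_add_one (by positivity)).le.trans ?_
      have h1 : 1 ≤ 4 * x ^ 2 / ε := by rw [le_div_iff₀ hε]; linarith
      have h2 : 12 / ε * x ^ 2 = 8 * x ^ 2 / ε + 4 * x ^ 2 / ε := by ring
      linarith
    set q := ⌈8 * x ^ 2 / ε⌉₊
    have hrate : M ^ 2 / Δ ^ 3 = x ^ 2 / Δ := by rw [hMx]; field_simp
    rw [hrate]
    rcases hα with rfl | rfl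
    · obtain ⟨μ, hμ, hμ1, hμ2⟩ := hlaw Δ hΔ
      refine ⟨q, μ, hμ, by simp, averageCost_le hμ1 ?_, fun V _ _ _ H ψ h hHM => ?_⟩
      · rw [pow_zero, mul_one]
        calc (q : ℝ) * (C₀ / Δ) ≤ 12 / ε * x ^ 2 * ((C₀ + 4 * C₁) / Δ) := by
              gcongr
              linarith
          _ = _ := by ring
      · subst hHM
        exact h.one_sub_le_fidelity_output hΔ hε hsmall hxε le_rfl (by positivity) hμ2 hq1
    · obtain ⟨n, hn1, hn2⟩ := exists_nat_half_pow_le hε hε1 hxε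
      obtain ⟨μ, hμ, hμ0, hμ1, hμ2⟩ := exists_law_nonneg_of_gap hΔ n
      refine ⟨q, μ, hμ, fun _ => hμ0, averageCost_le hμ1 ?_, fun V _ _ _ H ψ h hHM => ?_⟩
      · rw [pow_one]
        have hL : 0 ≤ max 1 (Real.log x) := by positivity
        calc (q : ℝ) * (n * 4 / Δ)
            ≤ 12 / ε * x ^ 2 * (C₁ * max 1 (Real.log x) * 4 / Δ) := by gcongr
          _ = 12 / ε * (4 * C₁) * (x ^ 2 / Δ * max 1 (Real.log x)) := by ring
          _ ≤ _ := by gcongr; linarith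
      · subst hHM
        exact h.one_sub_le_fidelity_output hΔ hε hsmall hxε (by positivity) hn1 hμ2 hq1
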